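/- Let $k$ be a field, $V$ a $k$-vector space, $\mathcal B$ a family of subspaces of $V$ and $V^+\in\mathcal B$, such that: (1) $A+B,\ A\cap B\in\mathcal B$ for $A,B\in\mathcal B$; (2) $\dim (A+B)/(A\cap B)<\infty$ for $A,B\in\mathcal B$; (3) $\bigcap_{A\in\mathcal B}A=0$; (4) $V\to\varprojlim_{A\in\mathcal B}V/A$ is surjective; (5) $\varinjlim_{A\in\mathcal B}A\to V/B$ is surjective for every $B\in\mathcal B$. A subspace of $V$ which contains a member of $\mathcal B$ with finite codimension is called a neighbourhood, and $\mathcal B_0$ denotes the set of neighbourhoods $A$ with $\dim A/(A\cap V^+)=\dim V^+/(A\cap V^+)$. The rational points of $\mathrm{Gr}(V)$ are the subspaces $L\subseteq V$ for which $L\cap V^+$ and $V/(L+V^+)$ are finite-dimensional of the same dimension. Let $D_L$ be the (one-dimensional) dual of the determinant line of the complex $L\to V/V^+$. For $A\in\mathcal B_0$, a generator of the line $\bigwedge^{\max}(A/A\cap V^+)\otimes\bigwedge^{\max}(V^+/A\cap V^+)^*$ and the determinant of $L\to V/A$ define a section $\Omega_A$, $L\mapsto\Omega_A(L)\in D_L$,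 which is unique up to a nonzero scalar and does not vanish at $L$ if and only if $L\oplus A=V$. Let $\Omega$ be the $k$-vector space spanned by the sections $\Omega_A$, $A\in\mathcal B_0$. The Plücker map sends $L$ to the rational point of $\mathbb P\Omega^*=\operatorname{Proj}(S^\bullet\Omega)$ given by the one-dimensional quotient $\Omega\to D_L$, i.e. to the line of $\Omega^*$ dual to it. Let $L_1,L_2,L_3$ be three distinct rational points of $\mathrm{Gr}(V)$. Their images under the Plücker map lie in a line of $\mathbb P\Omega^*$ if and only if $$L_1\cap L_2\subseteq L_3\subseteq L_1+L_2$$ and both inclusions are of codimension $1$. -/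

import Mathlib

namespace InfGrass

noncomputable section

/-! ### Determinants of operators that differ from the identity by an operator of finite rank -/

section FredholmDet

variable {k M : Type*} [Field k] [AddCommGroup M] [Module k M]

theorem mapsTo_range_sub_one (T : M →ₗ[k] M) :
    ∀ x ∈ LinearMap.range (T - 1), T x ∈ LinearMap.range (T - 1) := by
  rintro _ ⟨y, rfl⟩
  exact ⟨T y, by simp⟩

/-- The determinant of `T = 1 + F` with `F` of finite rank: the determinant of `T` on the
finite-dimensional `T`-stable subspace `range (T - 1)`; `T` is the identity on the quotient. -/
def fdet (T : M →ₗ[k] M) : k :=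
  LinearMap.det (T.restrict (mapsTo_range_sub_one T))

/-- The same determinant can be computed on every larger finite-dimensional subspace. -/
theorem det_restrict_eq_fdet (T : M →ₗ[k] M) (U : Submodule k M) [FiniteDimensional k U]
    (h : LinearMap.range (T - 1) ≤ U) (hU : ∀ x ∈ U, T x ∈ U) :
    LinearMap.det (T.restrict hU) = fdet T := by
  set W : Submodule k U := (LinearMap.range (T - 1)).submoduleOf U with hW
  have hWs : W ≤ W.comap (T.restrict hU) := by
    intro x hx
    exact mapsTo_range_sub_one T x.1 hx
  rw [LinearMap.det_eq_det_mul_det W (T.restrict hU) hWs]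
  have h1 : W.mapQ W (T.restrict hU) hWs = LinearMap.id := by
    ext x
    simp only [LinearMap.comp_apply, Submodule.mkQ_apply, Submodule.mapQ_apply, LinearMap.id_apply]
    rw [Submodule.Quotient.eq]
    exact ⟨x.1, by simp⟩
  rw [h1, LinearMap.det_id, mul_one]
  let e : W ≃ₗ[k] LinearMap.range (T - 1) := Submodule.submoduleOfEquivOfLe h
  rw [← LinearMap.det_conj _ e]
  unfold fdet
  congr 1

theorem fdet_one : fdet (1 : M →ₗ[k] M) = 1 := by
  have := det_restrict_eq_fdet (1 : M →ₗ[k] M) ⊥ (by simp) (by simp)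
  rw [← this]
  exact LinearMap.det_eq_one_of_subsingleton _

theorem range_mul_sub_one_le (S T : M →ₗ[k] M) : LinearMap.range (S * T - 1) ≤
    LinearMap.range (S - 1) ⊔ LinearMap.range (T - 1) := by
  rintro _ ⟨y, rfl⟩
  have : (S * T - 1) y = (S - 1) (T y) + (T - 1) y := by simp
  rw [this]
  exact Submodule.add_mem_sup ⟨_, rfl⟩ ⟨_, rfl⟩

theorem fdet_mul (S T : M →ₗ[k] M) [FiniteDimensional k (LinearMap.range (S - 1))]
    [FiniteDimensional k (LinearMap.range (T - 1))] : fdet (S * T) = fdet S * fdet T := by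
  set U := LinearMap.range (S - 1) ⊔ LinearMap.range (T - 1) with hU
  have key : ∀ R : M →ₗ[k] M, LinearMap.range (R - 1) ≤ U → ∀ x ∈ U, R x ∈ U := by
    intro R hR x hx
    have : R x = (R - 1) x + x := by simp
    rw [this]
    exact U.add_mem (hR ⟨x, rfl⟩) hx
  have hS := key S le_sup_left
  have hT := key T le_sup_right
  have hST := key (S * T) (range_mul_sub_one_le S T)
  rw [← det_restrict_eq_fdet S U le_sup_left hS, ← det_restrict_eq_fdet T U le_sup_right hT,
    ← det_restrict_eq_fdet (S * T) U (range_mul_sub_one_le S T) hST, ← LinearMap.det_comp]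
  rfl

end FredholmDet

/-! ### Subspaces that are finite-dimensional relative to another one -/

section Relative

variable {k V : Type*} [Field k] [AddCommGroup V] [Module k V]

/-- The quotient `Q / (P ∩ Q)`; for `P ≤ Q` this is `Q / P`. -/
abbrev RelQuot (P Q : Submodule k V) : Type _ := Q ⧸ P.submoduleOf Q

theorem finite_relQuot_iff (P Q : Submodule k V) : FiniteDimensional k (RelQuot P Q) ↔
    ∃ F : Submodule k V, FiniteDimensional k F ∧ Q ≤ P ⊔ F := by
  constructor
  · intro h
    obtain ⟨C, hC⟩ := Submodule.exists_isCompl (P.submoduleOf Q)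
    have : FiniteDimensional k C :=
      LinearEquiv.finiteDimensional (Submodule.quotientEquivOfIsCompl _ _ hC)
    refine ⟨C.map Q.subtype, inferInstance, fun x hx => ?_⟩
    have hx' : (⟨x, hx⟩ : Q) ∈ P.submoduleOf Q ⊔ C := by rw [hC.sup_eq_top]; trivial
    obtain ⟨y, hy, z, hz, hyz⟩ := Submodule.mem_sup.1 hx'
    exact Submodule.mem_sup.2 ⟨y, hy, z, ⟨z, hz, rfl⟩, congrArg Subtype.val hyz⟩
  · rintro ⟨F, hF, hQ⟩
    have hle : Q.map P.mkQ ≤ F.map P.mkQ := by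
      refine (Submodule.map_mono hQ).trans ?_
      rw [Submodule.map_sup]
      simp
    have : FiniteDimensional k (Q.map P.mkQ) := Submodule.finiteDimensional_of_le hle
    have hk : P.submoduleOf Q = LinearMap.ker (P.mkQ.comp Q.subtype) := by
      ext x; simp [Submodule.submoduleOf]
    have hr : LinearMap.range (P.mkQ.comp Q.subtype) = Q.map P.mkQ := by
      rw [LinearMap.range_comp, Submodule.range_subtype]
    have : FiniteDimensional k (LinearMap.range (P.mkQ.comp Q.subtype)) := by rwa [hr]
    exact LinearEquiv.finiteDimensional ((Submodule.quotEquivOfEq _ _ hk) ≪≫ₗ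
      (LinearMap.quotKerEquivRange _)).symm

/-- A linear map with kernel and cokernel of the same finite dimension is inverted, up to an
operator of finite rank, by a linear isomorphism. -/
theorem exists_equiv_of_index_zero {M N : Type*} [AddCommGroup M] [Module k M] [AddCommGroup N]
    [Module k N] (f : M →ₗ[k] N) [FiniteDimensional k (LinearMap.ker f)]
    [FiniteDimensional k (N ⧸ LinearMap.range f)]
    (h : Module.finrank k (LinearMap.ker f) = Module.finrank k (N ⧸ LinearMap.range f)) :
    ∃ w : N ≃ₗ[k] M, FiniteDimensional k (LinearMap.range (f ∘ₗ w.toLinearMap - 1)) := by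
  obtain ⟨C, hC⟩ := Submodule.exists_isCompl (LinearMap.ker f)
  obtain ⟨R, hR⟩ := Submodule.exists_isCompl (LinearMap.range f)
  let q := Submodule.quotientEquivOfIsCompl _ _ hR
  have : FiniteDimensional k R := LinearEquiv.finiteDimensional q
  have hfr : Module.finrank k (LinearMap.ker f) = Module.finrank k R := by
    rw [h, q.finrank_eq]
  let e : LinearMap.ker f ≃ₗ[k] R := LinearEquiv.ofFinrankEq _ _ hfr
  let g : C ≃ₗ[k] LinearMap.range f := f.kerComplementEquivRange hC.symm
  let w : N ≃ₗ[k] M := (Submodule.prodEquivOfIsCompl _ _ hR).symm ≪≫ₗ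
    (g.symm.prodCongr e.symm) ≪≫ₗ (Submodule.prodEquivOfIsCompl _ _ hC.symm)
  refine ⟨w, ?_⟩
  have hle : LinearMap.range (f ∘ₗ w.toLinearMap - 1) ≤ R := by
    rintro _ ⟨y, rfl⟩
    obtain ⟨⟨a, b⟩, rfl⟩ := (Submodule.prodEquivOfIsCompl _ _ hR).surjective y
    have hg : f (g.symm a : M) = a := by
      have := congrArg Subtype.val (g.apply_symm_apply a)
      simpa [g] using this
    have he : f (e.symm b : M) = 0 := (e.symm b).2
    have : (f ∘ₗ w.toLinearMap - 1) ((Submodule.prodEquivOfIsCompl _ _ hR) (a, b)) = -(b : N) := by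
      simp [w, hg, he]
    rw [this]
    exact R.neg_mem b.2
  exact Submodule.finiteDimensional_of_le hle

end Relative

/-! ### The pair `(V, 𝓑)` and the subspace `V⁺` -/

/-- A family `𝓑` of neighbourhoods of `0` in a `k`-vector space `V`, with a distinguished
member `V⁺`. -/
structure GrassData (k V : Type*) [Field k] [AddCommGroup V] [Module k V] where
  /-- the family `𝓑` -/
  nhd : Set (Submodule k V)
  /-- the subspace `V⁺` -/
  plus : Submodule k V
  plus_mem : plus ∈ nhd
  sup_mem : ∀ A ∈ nhd, ∀ B ∈ nhd, A ⊔ B ∈ nhd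
  inf_mem : ∀ A ∈ nhd, ∀ B ∈ nhd, A ⊓ B ∈ nhd
  /-- any two members are commensurable -/
  commensurable : ∀ A ∈ nhd, ∀ B ∈ nhd, FiniteDimensional k (RelQuot (A ⊓ B) (A ⊔ B))
  /-- the topology is separated -/
  separated : sInf nhd = ⊥
  /-- `V` is complete: `V` maps onto the inverse limit of the `V / A`, `A ∈ 𝓑` -/
  complete : ∀ x : (A : nhd) → V ⧸ (A : Submodule k V),
    (∀ (A B : nhd) (h : (A : Submodule k V) ≤ B), Submodule.factor h (x A) = x B) →
      ∃ v : V, ∀ A : nhd, Submodule.Quotient.mk v = x A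
  /-- the direct limit (that is, the union) of the `A ∈ 𝓑` maps onto `V / B` for `B ∈ 𝓑` -/
  exhaustive : ∀ B ∈ nhd, ∀ x : V ⧸ B, ∃ A ∈ nhd, ∃ a ∈ A, Submodule.Quotient.mk a = x

namespace GrassData

variable {k V : Type*} [Field k] [AddCommGroup V] [Module k V] (D : GrassData k V)

/-- The subspaces that belong to `𝓑` in the wide sense: those that contain a member of `𝓑` as a
subspace of finite codimension. (The preimages in `V` of the finite-dimensional subspaces of the
quotients `V / B`, `B ∈ 𝓑`. If these are all in `𝓑`, as for `V = k((z))`, this is `𝓑` itself.) -/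
def nhdSat : Set (Submodule k V) :=
  {A | ∃ B ∈ D.nhd, B ≤ A ∧ FiniteDimensional k (RelQuot B A)}

/-- The set `𝓑₀` of the neighbourhoods `A` with `dim A / (A ∩ V⁺) = dim V⁺ / (A ∩ V⁺)`. -/
def nhdZero : Set (Submodule k V) :=
  {A | A ∈ D.nhdSat ∧ Module.finrank k (RelQuot (A ⊓ D.plus) A) =
    Module.finrank k (RelQuot (A ⊓ D.plus) D.plus)}

/-- The rational points of the Grassmannian of all indices. -/
def GrBullet : Set (Submodule k V) :=
  {L | FiniteDimensional k ↥(L ⊓ D.plus) ∧ FiniteDimensional k (V ⧸ (L ⊔ D.plus))}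

/-- The index function on rational points. -/
def index (L : Submodule k V) : ℤ :=
  (Module.finrank k ↥(L ⊓ D.plus) : ℤ) - Module.finrank k (V ⧸ (L ⊔ D.plus))

/-- The rational points of the Grassmannian `Gr(V)`: the points of index `0`. -/
def Gr : Set (Submodule k V) := {L | L ∈ D.GrBullet ∧ D.index L = 0}

/-! ### The dual determinant bundle -/

/-- The map `L → V / A` whose determinant is taken. -/
def proj (A L : Submodule k V) : L →ₗ[k] V ⧸ A := A.mkQ ∘ₗ L.subtype

/-- Frames of the determinant of the complex `L → V / V⁺`: isomorphisms `w : V / V⁺ ≃ L` whose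
composite with the projection `L → V / V⁺` differs from the identity by an operator of finite
rank. The determinant of the complex is the line generated by the frames, where two frames
`w`, `w'` are related by `w' = fdet (w⁻¹ w') • w`. -/
def Frame (L : Submodule k V) : Type _ :=
  {w : (V ⧸ D.plus) ≃ₗ[k] L //
    FiniteDimensional k (LinearMap.range (proj D.plus L ∘ₗ w.toLinearMap - 1))}

/-- The operator `w⁻¹ w'` that compares two frames. -/
def Frame.compare {D : GrassData k V} {L : Submodule k V} (w w' : D.Frame L) :
    (V ⧸ D.plus) →ₗ[k] (V ⧸ D.plus) :=
  w.1.symm.toLinearMap ∘ₗ w'.1.toLinearMap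

/-- The fibre at `L` of the dual of the determinant bundle: linear forms on the determinant line,
given by their values on the frames. -/
def detDual (L : Submodule k V) : Submodule k (D.Frame L → k) where
  carrier := {f | ∀ w w', f w' = fdet (w.compare w') * f w}
  add_mem' := by
    intro f g hf hg w w'
    simp only [Pi.add_apply, hf w w', hg w w', mul_add]
  zero_mem' := by intro w w'; simp
  smul_mem' := by
    intro c f hf w w'
    simp only [Pi.smul_apply, smul_eq_mul, hf w w']
    ring

/-- Generators of the line `⋀(A / A ∩ V⁺) ⊗ ⋀(V⁺ / A ∩ V⁺)*` (the relative determinant of `V / V⁺`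
and `V / A`), up to the unimodular ones: isomorphisms `θ : V / A ≃ V / V⁺` that are compatible
with the projections of `V` up to an operator of finite rank. -/
def RelFrame (A : Submodule k V) : Type _ :=
  {θ : (V ⧸ A) ≃ₗ[k] (V ⧸ D.plus) //
    FiniteDimensional k (LinearMap.range (θ.toLinearMap ∘ₗ A.mkQ - D.plus.mkQ))}

/-- The composite `V / V⁺ → L → V / A → V / V⁺` of a frame of `L`, the projection, and a relative
frame of `A`. -/
def sectionMap {D : GrassData k V} {A L : Submodule k V} (θ : D.RelFrame A) (w : D.Frame L) :
    (V ⧸ D.plus) →ₗ[k] (V ⧸ D.plus) :=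
  θ.1.toLinearMap ∘ₗ proj A L ∘ₗ w.1.toLinearMap

theorem finite_range_add {M N : Type*} [AddCommGroup M] [Module k M] [AddCommGroup N] [Module k N]
    (f g : M →ₗ[k] N) (hf : FiniteDimensional k (LinearMap.range f))
    (hg : FiniteDimensional k (LinearMap.range g)) :
    FiniteDimensional k (LinearMap.range (f + g)) :=
  Submodule.finiteDimensional_of_le (LinearMap.range_add_le f g)

theorem finite_range_comp_right {M N P : Type*} [AddCommGroup M] [Module k M] [AddCommGroup N]
    [Module k N] [AddCommGroup P] [Module k P] (f : N →ₗ[k] P) (g : M →ₗ[k] N)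
    (hf : FiniteDimensional k (LinearMap.range f)) :
    FiniteDimensional k (LinearMap.range (f ∘ₗ g)) :=
  Submodule.finiteDimensional_of_le (LinearMap.range_comp_le_range g f)

theorem finite_range_comp_left {M N P : Type*} [AddCommGroup M] [Module k M] [AddCommGroup N]
    [Module k N] [AddCommGroup P] [Module k P] (f : N →ₗ[k] P) (g : M →ₗ[k] N)
    (hg : FiniteDimensional k (LinearMap.range g)) :
    FiniteDimensional k (LinearMap.range (f ∘ₗ g)) := by
  rw [LinearMap.range_comp]
  infer_instance

theorem finite_range_sectionMap {A L : Submodule k V} (θ : D.RelFrame A) (w : D.Frame L) :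
    FiniteDimensional k (LinearMap.range (sectionMap θ w - 1)) := by
  have h : sectionMap θ w - 1 =
      (θ.1.toLinearMap ∘ₗ A.mkQ - D.plus.mkQ) ∘ₗ (L.subtype ∘ₗ w.1.toLinearMap) +
        (proj D.plus L ∘ₗ w.1.toLinearMap - 1) := by
    apply LinearMap.ext
    intro x
    simp [sectionMap, proj]
  rw [h]
  exact finite_range_add _ _ (finite_range_comp_right _ _ θ.2) w.2

theorem finite_ker_proj {L : Submodule k V} (hL : L ∈ D.GrBullet) :
    FiniteDimensional k (LinearMap.ker (proj D.plus L)) := by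
  have := hL.1
  have h : (LinearMap.ker (proj D.plus L)).map L.subtype ≤ L ⊓ D.plus := by
    rintro _ ⟨x, hx, rfl⟩
    exact ⟨x.2, by simpa [proj] using hx⟩
  have := Submodule.finiteDimensional_of_le h
  exact LinearEquiv.finiteDimensional
    (Submodule.equivMapOfInjective L.subtype L.injective_subtype
      (LinearMap.ker (proj D.plus L))).symm

theorem finite_range_compare {L : Submodule k V} (hL : L ∈ D.GrBullet) (w w' : D.Frame L) :
    FiniteDimensional k (LinearMap.range (w.compare w' - 1)) := by
  have h : w.compare w' - 1 = w.1.symm.toLinearMap ∘ₗ (w'.1.toLinearMap - w.1.toLinearMap) := by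
    apply LinearMap.ext
    intro x
    simp [Frame.compare]
  rw [h]
  apply finite_range_comp_left
  set g := w'.1.toLinearMap - w.1.toLinearMap with hg
  have h1 : FiniteDimensional k (LinearMap.range (proj D.plus L ∘ₗ g)) := by
    have : proj D.plus L ∘ₗ g = (proj D.plus L ∘ₗ w'.1.toLinearMap - 1) +
        (-LinearMap.id) ∘ₗ (proj D.plus L ∘ₗ w.1.toLinearMap - 1) := by
      apply LinearMap.ext
      intro x
      simp [hg]
    rw [this]
    exact finite_range_add _ _ w'.2 (finite_range_comp_left _ _ w.2)
  have h2 := D.finite_ker_proj hL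
  rw [LinearMap.range_comp] at h1
  have hfg : (LinearMap.range g).FG := by
    refine Submodule.fg_of_fg_map_of_fg_inf_ker (proj D.plus L) ?_ ?_
    · exact (Submodule.fg_iff_finiteDimensional _).2 h1
    · exact (Submodule.fg_iff_finiteDimensional _).2
        (Submodule.finiteDimensional_of_le inf_le_right)
  exact (Submodule.fg_iff_finiteDimensional _).1 hfg

/-- The value at `L` of the section attached to `A` (and to a relative frame of `A`): the
determinant of `L → V / A`. -/
def sectionAt {A : Submodule k V} (θ : D.RelFrame A) (L : D.Gr) : D.detDual L :=
  ⟨fun w => fdet (sectionMap θ w), by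
    intro w w'
    have h1 := D.finite_range_sectionMap θ w
    have h2 := D.finite_range_compare L.2.1 w w'
    have h : sectionMap θ w' = sectionMap θ w * w.compare w' := by
      apply LinearMap.ext
      intro x
      simp [sectionMap, Frame.compare]
    change fdet (sectionMap θ w') = _ * fdet (sectionMap θ w)
    rw [h, fdet_mul, mul_comm]⟩

/-- The space `Ω` of sections (on the rational points) of the dual determinant bundle spanned by
the sections `Ω_A`, `A ∈ 𝓑₀`. -/
def Omega : Submodule k ((L : D.Gr) → D.detDual (L : Submodule k V)) :=
  Submodule.span k {s | ∃ A ∈ D.nhdZero, ∃ θ : D.RelFrame A, s = D.sectionAt θ}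

/-- The evaluation `Ω → D_L` at a rational point `L`. -/
def evalAt (L : D.Gr) : D.Omega →ₗ[k] D.detDual (L : Submodule k V) :=
  LinearMap.proj L ∘ₗ D.Omega.subtype

/-! ### The Plücker map on rational points -/

theorem exists_frame (L : D.Gr) : Nonempty (D.Frame (L : Submodule k V)) := by
  obtain ⟨L, hL, hi⟩ := L
  have h1 := D.finite_ker_proj hL
  have hk : (LinearMap.ker (proj D.plus L)).map L.subtype = L ⊓ D.plus := by
    ext x
    constructor
    · rintro ⟨x, hx, rfl⟩
      exact ⟨x.2, by simpa [proj] using hx⟩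
    · rintro ⟨hx, hx'⟩
      exact ⟨⟨x, hx⟩, by simpa [proj] using hx', rfl⟩
  have hr : LinearMap.range (proj D.plus L) = L.map D.plus.mkQ := by
    rw [proj, LinearMap.range_comp, Submodule.range_subtype]
  let q : ((V ⧸ D.plus) ⧸ LinearMap.range (proj D.plus L)) ≃ₗ[k] V ⧸ (L ⊔ D.plus) :=
    (Submodule.quotEquivOfEq _ _ hr) ≪≫ₗ (Submodule.quotientQuotientEquivQuotientSup D.plus L) ≪≫ₗ
      (Submodule.quotEquivOfEq _ _ (sup_comm _ _))
  have := hL.2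
  have h2 : FiniteDimensional k ((V ⧸ D.plus) ⧸ LinearMap.range (proj D.plus L)) :=
    LinearEquiv.finiteDimensional q.symm
  obtain ⟨w, hw⟩ := exists_equiv_of_index_zero (proj D.plus L) (by
    rw [q.finrank_eq, (Submodule.equivMapOfInjective L.subtype L.injective_subtype
      (LinearMap.ker (proj D.plus L))).finrank_eq, hk]
    have := hi
    simp only [index] at this
    omega)
  exact ⟨⟨w, hw⟩⟩

theorem finrank_detDual (L : D.Gr) : Module.finrank k (D.detDual (L : Submodule k V)) = 1 := by
  obtain ⟨w₀⟩ := D.exists_frame L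
  have hc : ∀ w : D.Frame (L : Submodule k V), w.compare w = 1 := by
    intro w
    apply LinearMap.ext
    intro x
    simp [Frame.compare]
  let f₀ : D.detDual (L : Submodule k V) := ⟨fun w => fdet (w₀.compare w), by
    intro w w'
    have h1 := D.finite_range_compare L.2.1 w₀ w
    have h2 := D.finite_range_compare L.2.1 w w'
    have h : w₀.compare w' = w₀.compare w * w.compare w' := by
      apply LinearMap.ext
      intro x
      simp [Frame.compare]
    change fdet (w₀.compare w') = _ * fdet (w₀.compare w)
    rw [h, fdet_mul, mul_comm]⟩
  refine finrank_eq_one f₀ ?_ ?_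
  · intro h
    have := congrFun (congrArg Subtype.val h) w₀
    simp [f₀, hc, fdet_one] at this
  · intro f
    refine ⟨f.1 w₀, Subtype.ext (funext fun w => ?_)⟩
    have := f.2 w₀ w
    simp only [f₀, Submodule.coe_smul, Pi.smul_apply, smul_eq_mul]
    rw [this, mul_comm]

/-- Some member of `𝓑` meets a given finite-dimensional subspace only in `0`. -/
theorem exists_disjoint (K : Submodule k V) [FiniteDimensional k K] :
    ∃ B ∈ D.nhd, K ⊓ B = ⊥ := by
  obtain ⟨B, hB, hmin⟩ := exists_minimal_of_wellFoundedLT (fun n : ℕ => ∃ B ∈ D.nhd,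
    Module.finrank k ↥(K ⊓ B) = n) ⟨_, D.plus, D.plus_mem, rfl⟩ |>.imp fun n hn => hn
  obtain ⟨B', hB', rfl⟩ := hB
  refine ⟨B', hB', ?_⟩
  by_contra hne
  obtain ⟨x, hx, hx0⟩ := Submodule.exists_mem_ne_zero_of_ne_bot hne
  have hx1 : x ∉ sInf D.nhd := by rw [D.separated]; simpa using hx0
  rw [Submodule.mem_sInf] at hx1
  push Not at hx1
  obtain ⟨C, hC, hxC⟩ := hx1
  have hlt : K ⊓ (B' ⊓ C) < K ⊓ B' := by
    refine lt_of_le_of_ne (inf_le_inf_left _ inf_le_left) fun h => hxC ?_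
    rw [← h] at hx
    exact hx.2.2
  have hfin : FiniteDimensional k ↥(K ⊓ B') := Submodule.finiteDimensional_of_le inf_le_left
  have h1 := Submodule.finrank_lt_finrank_of_lt hlt
  have h2 := hmin ⟨B' ⊓ C, D.inf_mem _ hB' _ hC, rfl⟩ h1.le
  omega

theorem nhdSat_le {A : Submodule k V} (hA : A ∈ D.nhdSat) :
    (∃ F : Submodule k V, FiniteDimensional k F ∧ A ≤ D.plus ⊔ F) ∧
      ∃ F : Submodule k V, FiniteDimensional k F ∧ D.plus ≤ A ⊔ F := by
  obtain ⟨B, hB, hBA, hfin⟩ := hA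
  obtain ⟨F, hF, hAF⟩ := (finite_relQuot_iff _ _).1 hfin
  obtain ⟨G, hG, hBG⟩ := (finite_relQuot_iff _ _).1 (D.commensurable B hB D.plus D.plus_mem)
  refine ⟨⟨G ⊔ F, inferInstance, ?_⟩, ⟨G, hG, ?_⟩⟩
  · refine hAF.trans (sup_le ?_ (le_sup_right.trans le_sup_right))
    refine (le_sup_left.trans hBG).trans (sup_le (inf_le_right.trans le_sup_left) ?_)
    exact le_sup_left.trans le_sup_right
  · exact (le_sup_right.trans hBG).trans (sup_le_sup_right (inf_le_left.trans hBA) _)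

theorem mem_nhdZero_of_isCompl {L A : Submodule k V} (hL : L ∈ D.Gr) (hA : A ∈ D.nhdSat)
    (hLA : IsCompl L A) : A ∈ D.nhdZero := by
  refine ⟨hA, ?_⟩
  obtain ⟨⟨hL1, hL2⟩, hi⟩ := hL
  set P := D.plus with hP
  set I := A ⊓ P with hI
  have hX : FiniteDimensional k (RelQuot I P) := by
    obtain ⟨F, hF, hPF⟩ := (D.nhdSat_le hA).2
    have : FiniteDimensional k (RelQuot A P) := (finite_relQuot_iff _ _).2 ⟨F, hF, hPF⟩
    have e : A.submoduleOf P = I.submoduleOf P := by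
      ext x; simp [Submodule.submoduleOf, hI]
    exact LinearEquiv.finiteDimensional (Submodule.quotEquivOfEq _ _ e)
  have hXA : FiniteDimensional k (RelQuot I A) := by
    obtain ⟨F, hF, hPF⟩ := (D.nhdSat_le hA).1
    have : FiniteDimensional k (RelQuot P A) := (finite_relQuot_iff _ _).2 ⟨F, hF, hPF⟩
    have e : P.submoduleOf A = I.submoduleOf A := by
      ext x; simp [Submodule.submoduleOf, hI]
    exact LinearEquiv.finiteDimensional (Submodule.quotEquivOfEq _ _ e)
  -- `A / I ≃ V / (L + I)`
  let χ : A →ₗ[k] V ⧸ (L ⊔ I) := (L ⊔ I).mkQ ∘ₗ A.subtype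
  have hχs : Function.Surjective χ := by
    intro y
    obtain ⟨v, rfl⟩ := Submodule.mkQ_surjective _ y
    have hv : v ∈ L ⊔ A := by rw [hLA.sup_eq_top]; trivial
    obtain ⟨l, hl, a, ha, rfl⟩ := Submodule.mem_sup.1 hv
    refine ⟨⟨a, ha⟩, ?_⟩
    change Submodule.Quotient.mk a = Submodule.Quotient.mk (l + a)
    rw [Submodule.Quotient.eq]
    simpa using Submodule.mem_sup_left (T := I) hl
  have hχk : I.submoduleOf A = LinearMap.ker χ := by
    ext ⟨a, ha⟩
    simp only [Submodule.submoduleOf, Submodule.mem_comap, LinearMap.mem_ker, χ,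
      LinearMap.comp_apply, Submodule.subtype_apply, Submodule.mkQ_apply,
      Submodule.Quotient.mk_eq_zero]
    constructor
    · exact fun h => Submodule.mem_sup_right h
    · intro h
      obtain ⟨l, hl, i, hi, hli⟩ := Submodule.mem_sup.1 h
      have hlA : l ∈ L ⊓ A := ⟨hl, by
        have : l = a - i := by rw [← hli]; abel
        rw [this]
        exact A.sub_mem ha hi.1⟩
      rw [hLA.inf_eq_bot, Submodule.mem_bot] at hlA
      rw [← hli, hlA, zero_add]
      exact hi
  let eY : RelQuot I A ≃ₗ[k] V ⧸ (L ⊔ I) :=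
    (Submodule.quotEquivOfEq _ _ hχk) ≪≫ₗ (χ.quotKerEquivOfSurjective hχs)
  have hY : FiniteDimensional k (V ⧸ (L ⊔ I)) := LinearEquiv.finiteDimensional eY
  rw [eY.finrank_eq]
  -- `P / I → V / (L + I)`
  let φ : RelQuot I P →ₗ[k] V ⧸ (L ⊔ I) :=
    (I.submoduleOf P).mapQ (L ⊔ I) P.subtype fun x hx => Submodule.mem_sup_right hx
  have hφr : LinearMap.range φ = P.map (L ⊔ I).mkQ := by
    ext y
    constructor
    · rintro ⟨x, rfl⟩
      obtain ⟨x, rfl⟩ := Submodule.mkQ_surjective _ x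
      exact ⟨x.1, x.2, rfl⟩
    · rintro ⟨x, hx, rfl⟩
      exact ⟨Submodule.Quotient.mk ⟨x, hx⟩, rfl⟩
  have hsup : L ⊔ I ⊔ P = L ⊔ P := by
    rw [sup_assoc, sup_eq_right.2 (inf_le_right : I ≤ P)]
  let q : ((V ⧸ (L ⊔ I)) ⧸ LinearMap.range φ) ≃ₗ[k] V ⧸ (L ⊔ P) :=
    (Submodule.quotEquivOfEq _ _ hφr) ≪≫ₗ (Submodule.quotientQuotientEquivQuotientSup _ P) ≪≫ₗ
      (Submodule.quotEquivOfEq _ _ hsup)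
  let ψ : ↥(L ⊓ P) →ₗ[k] RelQuot I P :=
    (I.submoduleOf P).mkQ ∘ₗ Submodule.inclusion (inf_le_right : L ⊓ P ≤ P)
  have hψi : Function.Injective ψ := by
    rw [injective_iff_map_eq_zero]
    intro x hx
    have hx₀ : Submodule.inclusion (inf_le_right : L ⊓ P ≤ P) x ∈ I.submoduleOf P :=
      (Submodule.Quotient.mk_eq_zero _).1 hx
    have hx' : (x : V) ∈ I := hx₀
    have : (x : V) ∈ L ⊓ A := ⟨x.2.1, hx'.1⟩
    rw [hLA.inf_eq_bot, Submodule.mem_bot] at this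
    exact Subtype.ext this
  have hψr : LinearMap.range ψ = LinearMap.ker φ := by
    ext y
    constructor
    · rintro ⟨x, rfl⟩
      exact (Submodule.Quotient.mk_eq_zero _).2 (Submodule.mem_sup_left x.2.1)
    · intro hy
      obtain ⟨⟨y, hyP⟩, rfl⟩ := Submodule.mkQ_surjective _ y
      have hy' : y ∈ L ⊔ I := (Submodule.Quotient.mk_eq_zero _).1 hy
      obtain ⟨l, hl, i, hi, hli⟩ := Submodule.mem_sup.1 hy'
      have hlP : l ∈ P := by
        have : l = y - i := by rw [← hli]; abel
        rw [this]
        exact P.sub_mem hyP hi.2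
      refine ⟨⟨l, hl, hlP⟩, (Submodule.Quotient.eq _).2 ?_⟩
      change l - y ∈ I
      have : l - y = -i := by rw [← hli]; abel
      rw [this]
      exact I.neg_mem hi
  have h1 := LinearMap.finrank_range_add_finrank_ker φ
  have h2 := Submodule.finrank_quotient_add_finrank (LinearMap.range φ)
  have h3 := LinearMap.finrank_range_of_inj hψi
  rw [hψr] at h3
  rw [q.finrank_eq] at h2
  simp only [index] at hi
  rw [← hP] at hi
  omega

/-- Every rational point has a complement in `𝓑₀`: the open sets `F_A` cover. -/
theorem exists_compl (L : D.Gr) : ∃ A ∈ D.nhdZero, IsCompl (L : Submodule k V) A := by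
  obtain ⟨L, hL⟩ := L
  have hL1 := hL.1.1
  have hL2 := hL.1.2
  obtain ⟨B₀, hB₀, hdis⟩ := D.exists_disjoint (L ⊓ D.plus)
  set B := D.plus ⊓ B₀ with hBdef
  have hB : B ∈ D.nhd := D.inf_mem _ D.plus_mem _ hB₀
  have hLB : Disjoint L B := by
    rw [disjoint_iff, hBdef, ← inf_assoc, hdis]
  have hBsat : B ∈ D.nhdSat := ⟨B, hB, le_rfl, (finite_relQuot_iff _ _).2
    ⟨⊥, inferInstance, le_sup_left⟩⟩
  obtain ⟨F, hF, hPF⟩ := (D.nhdSat_le hBsat).2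
  obtain ⟨G, hG⟩ := Submodule.exists_isCompl (L ⊔ D.plus)
  have hGf : FiniteDimensional k G :=
    LinearEquiv.finiteDimensional (Submodule.quotientEquivOfIsCompl _ _ hG)
  obtain ⟨C, hC⟩ := Submodule.exists_isCompl (L ⊔ B)
  have htop : (⊤ : Submodule k V) ≤ (L ⊔ B) ⊔ (F ⊔ G) := by
    rw [← hG.sup_eq_top]
    refine sup_le (sup_le (le_sup_left.trans le_sup_left) (hPF.trans ?_))
      (le_sup_right.trans le_sup_right)
    exact sup_le_sup le_sup_right le_sup_left
  have hq : FiniteDimensional k (RelQuot (L ⊔ B) C) :=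
    (finite_relQuot_iff _ _).2 ⟨F ⊔ G, inferInstance, le_top.trans htop⟩
  have hCf : FiniteDimensional k C := by
    have e : (L ⊔ B).submoduleOf C = ⊥ := by
      rw [Submodule.submoduleOf, ← Submodule.disjoint_iff_comap_eq_bot]
      exact hC.disjoint.symm
    exact LinearEquiv.finiteDimensional
      ((Submodule.quotEquivOfEq _ _ e) ≪≫ₗ (Submodule.quotEquivOfEqBot _ rfl))
  have hcompl : IsCompl L (B ⊔ C) := by
    refine ⟨hLB.disjoint_sup_right_of_disjoint_sup_left hC.disjoint, ?_⟩
    rw [codisjoint_iff, ← sup_assoc, hC.sup_eq_top]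
  have hsat : B ⊔ C ∈ D.nhdSat :=
    ⟨B, hB, le_sup_left, (finite_relQuot_iff _ _).2 ⟨C, hCf, le_rfl⟩⟩
  exact ⟨B ⊔ C, D.mem_nhdZero_of_isCompl hL hsat hcompl, hcompl⟩

theorem exists_relFrame {A : Submodule k V} (hA : A ∈ D.nhdZero) {L : Submodule k V}
    (hLA : IsCompl L A) (w : D.Frame L) : ∃ θ : D.RelFrame A, sectionMap θ w = 1 := by
  let p := Submodule.quotientEquivOfIsCompl A L hLA.symm
  let θ : (V ⧸ A) ≃ₗ[k] (V ⧸ D.plus) := p ≪≫ₗ w.1.symm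
  have hpl : ∀ l : L, p (Submodule.Quotient.mk (l : V)) = l := fun l =>
    Submodule.quotientEquivOfIsCompl_apply_mk_right hLA.symm l
  obtain ⟨F, hF, hAF⟩ := (D.nhdSat_le hA.1).1
  have hAm : FiniteDimensional k (A.map D.plus.mkQ) := by
    have hle : A.map D.plus.mkQ ≤ F.map D.plus.mkQ := by
      refine (Submodule.map_mono hAF).trans ?_
      rw [Submodule.map_sup]
      simp
    exact Submodule.finiteDimensional_of_le hle
  have hw := w.2
  have hle : LinearMap.range (θ.toLinearMap ∘ₗ A.mkQ - D.plus.mkQ) ≤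
      A.map D.plus.mkQ ⊔ LinearMap.range (proj D.plus L ∘ₗ w.1.toLinearMap - 1) := by
    rintro _ ⟨v, rfl⟩
    have hv : v ∈ A ⊔ L := by rw [hLA.symm.sup_eq_top]; trivial
    obtain ⟨a, ha, l, hl, rfl⟩ := Submodule.mem_sup.1 hv
    rw [map_add]
    refine Submodule.add_mem_sup ?_ ?_
    · refine ⟨-a, A.neg_mem ha, ?_⟩
      have : A.mkQ a = 0 := by simpa using ha
      simp only [LinearMap.sub_apply, LinearMap.comp_apply, this, map_zero, map_neg, zero_sub]
    · refine ⟨-(w.1.symm ⟨l, hl⟩), ?_⟩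
      have h1 : θ (A.mkQ l) = w.1.symm ⟨l, hl⟩ := congrArg w.1.symm (hpl ⟨l, hl⟩)
      simp only [LinearMap.sub_apply, LinearMap.comp_apply, LinearEquiv.coe_coe, h1, map_neg,
        LinearEquiv.apply_symm_apply, Module.End.one_apply]
      simp [proj]
  refine ⟨⟨θ, Submodule.finiteDimensional_of_le hle⟩, ?_⟩
  apply LinearMap.ext
  intro x
  change w.1.symm (p (Submodule.Quotient.mk (w.1 x : V))) = x
  rw [hpl, LinearEquiv.symm_apply_apply]

theorem surjective_evalAt (L : D.Gr) : Function.Surjective (D.evalAt L) := by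
  obtain ⟨w⟩ := D.exists_frame L
  obtain ⟨A, hA, hLA⟩ := D.exists_compl L
  obtain ⟨θ, hθ⟩ := D.exists_relFrame hA hLA w
  have hne : D.sectionAt θ L ≠ 0 := by
    intro h
    have := congrFun (congrArg Subtype.val h) w
    simp [sectionAt, hθ, fdet_one] at this
  intro f
  obtain ⟨c, hc⟩ := exists_smul_eq_of_finrank_eq_one (D.finrank_detDual L) hne f
  exact ⟨c • ⟨D.sectionAt θ, Submodule.subset_span ⟨A, hA, θ, rfl⟩⟩, hc⟩

/-- The line in `Ω*` that is dual to the one-dimensional quotient `Ω → D_L`. -/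
theorem finrank_range_dualMap (L : D.Gr) :
    Module.finrank k (LinearMap.range (D.evalAt L).dualMap) = 1 := by
  rw [LinearMap.finrank_range_of_inj
    (LinearMap.dualMap_injective_of_surjective (D.surjective_evalAt L)),
    Subspace.dual_finrank_eq, D.finrank_detDual L]

/-- The Plücker map on rational points. The rational points of `ℙΩ* = Proj (Sym Ω)` are the
one-dimensional quotients of `Ω`, or, dually, the points of the projectivization of the dual space
`Ω*`; the point `L` goes to the quotient `Ω → D_L`. -/
def plucker (L : D.Gr) : Projectivization k (Module.Dual k D.Omega) :=
  Projectivization.mk'' (LinearMap.range (D.evalAt L).dualMap) (D.finrank_range_dualMap L)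

end GrassData

/-- Three points of the projectivization of `E` lie in a line, a line being given by a
two-dimensional subspace of `E`. -/
def LieInALine {k E : Type*} [Field k] [AddCommGroup E] [Module k E]
    (p₁ p₂ p₃ : Projectivization k E) : Prop :=
  ∃ W : Submodule k E, Module.finrank k W = 2 ∧
    p₁.submodule ≤ W ∧ p₂.submodule ≤ W ∧ p₃.submodule ≤ W

/-- `P ⊆ Q`, of codimension `1`. -/
def LeOfCodimOne {k V : Type*} [Field k] [AddCommGroup V] [Module k V]
    (P Q : Submodule k V) : Prop :=
  P ≤ Q ∧ Module.finrank k (RelQuot P Q) = 1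

end

end InfGrass

namespace InfGrass

/-! ### Vanishing and additivity of the determinant -/

section FredholmDet

variable {k M : Type*} [Field k] [AddCommGroup M] [Module k M]

/-- A kernel vector satisfies `x = (T - 1) (-x)`, so it lies in the subspace on which `fdet` is
computed. -/
theorem fdet_eq_zero_of_apply_eq_zero (T : M →ₗ[k] M)
    [FiniteDimensional k (LinearMap.range (T - 1))] {x : M} (hx : x ≠ 0) (hTx : T x = 0) :
    fdet T = 0 := by
  have hxr : x ∈ LinearMap.range (T - 1) := ⟨-x, by simp [hTx]⟩
  by_contra h
  have hb := LinearMap.ker_eq_bot'.1 (LinearMap.equivOfDetNeZero _ h).ker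
  refine hx (congrArg Subtype.val (hb ⟨x, hxr⟩ (Subtype.ext ?_)))
  exact hTx

/-- Endomorphisms that agree on a hyperplane have determinants that are additive in the value at
a complementary vector. -/
theorem det_add_of_eqOn_ker [FiniteDimensional k M] (φ : M →ₗ[k] k) {p : M} (hp : φ p ≠ 0)
    {R S T : M →ₗ[k] M} (hS : ∀ x, φ x = 0 → S x = R x) (hT : ∀ x, φ x = 0 → T x = R x)
    (hadd : R p = S p + T p) :
    LinearMap.det R = LinearMap.det S + LinearMap.det T := by
  let c := Module.finBasis k (LinearMap.ker φ)
  let b := Module.Basis.mkFinCons p c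
    (by
      intro a x hx h
      have := congrArg φ h
      simpa [LinearMap.mem_ker.1 hx, hp] using this)
    (by
      intro z
      refine ⟨-(φ z / φ p), ?_⟩
      simp [hp])
  have hb : (b : Fin (_ + 1) → M) = Fin.cons p ((↑) ∘ c) := Module.Basis.coe_mkFinCons ..
  -- In the basis `p`, followed by a basis of `ker φ`, only the image of `p` distinguishes `R`, `S`,
  -- `T`; additivity is then multilinearity in slot `0`.
  have key : ∀ Q : M →ₗ[k] M, (∀ x, φ x = 0 → Q x = R x) →
      LinearMap.det Q = b.det (Function.update (R ∘ b) 0 (Q p)) := by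
    intro Q hQ
    have h1 : LinearMap.det Q = b.det (Q ∘ b) := by
      rw [Module.Basis.det_comp, Module.Basis.det_self, mul_one]
    rw [h1]
    congr 1
    funext i
    refine Fin.cases ?_ (fun j => ?_) i
    · simp [hb]
    · simp only [Function.comp_apply, ne_eq, Fin.succ_ne_zero, not_false_eq_true,
        Function.update_of_ne]
      apply hQ
      simp [hb]
  rw [key R fun _ _ => rfl, key S hS, key T hT, hadd]
  exact b.det.map_update_add _ _ _ _

theorem fdet_add_of_eqOn_ker (φ : M →ₗ[k] k) {p : M} (hp : φ p ≠ 0) {R S T : M →ₗ[k] M}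
    [FiniteDimensional k (LinearMap.range (R - 1))]
    [FiniteDimensional k (LinearMap.range (S - 1))]
    [FiniteDimensional k (LinearMap.range (T - 1))]
    (hS : ∀ x, φ x = 0 → S x = R x) (hT : ∀ x, φ x = 0 → T x = R x)
    (hadd : R p = S p + T p) : fdet R = fdet S + fdet T := by
  -- One finite-dimensional subspace computes all three determinants; `p` is adjoined so that `φ`
  -- remains nonzero at a vector of `U`.
  let U := LinearMap.range (R - 1) ⊔ LinearMap.range (S - 1) ⊔ LinearMap.range (T - 1) ⊔
    Submodule.span k {p}
  have key : ∀ Q : M →ₗ[k] M, LinearMap.range (Q - 1) ≤ U → ∀ x ∈ U, Q x ∈ U := by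
    intro Q hQ x hx
    have : Q x = (Q - 1) x + x := by simp
    rw [this]
    exact U.add_mem (hQ ⟨x, rfl⟩) hx
  have hR' : LinearMap.range (R - 1) ≤ U := le_sup_left.trans (le_sup_left.trans le_sup_left)
  have hS' : LinearMap.range (S - 1) ≤ U := le_sup_right.trans (le_sup_left.trans le_sup_left)
  have hT' : LinearMap.range (T - 1) ≤ U := le_sup_right.trans le_sup_left
  have hpU : p ∈ U := Submodule.mem_sup_right (Submodule.mem_span_singleton_self p)
  rw [← det_restrict_eq_fdet R U hR' (key R hR'), ← det_restrict_eq_fdet S U hS' (key S hS'),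
    ← det_restrict_eq_fdet T U hT' (key T hT')]
  exact det_add_of_eqOn_ker (φ ∘ₗ U.subtype) (p := ⟨p, hpU⟩) hp
    (fun x hx => Subtype.ext (hS x hx)) (fun x hx => Subtype.ext (hT x hx)) (Subtype.ext hadd)

end FredholmDet

/-! ### Inclusions of codimension one -/

section Relative

variable {k V : Type*} [Field k] [AddCommGroup V] [Module k V]

theorem LeOfCodimOne.exists_notMem {P Q : Submodule k V} (h : LeOfCodimOne P Q) :
    ∃ x ∈ Q, x ∉ P := by
  by_contra! hQ
  have : Subsingleton (RelQuot P Q) := by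
    rw [Submodule.Quotient.subsingleton_iff, Submodule.submoduleOf_eq_top]
    exact hQ
  have := h.2
  rw [Module.finrank_zero_of_subsingleton] at this
  omega

theorem LeOfCodimOne.exists_add_smul {P Q : Submodule k V} (h : LeOfCodimOne P Q) {x : V}
    (hx : x ∈ Q) (hxP : x ∉ P) {y : V} (hy : y ∈ Q) : ∃ p ∈ P, ∃ c : k, p + c • x = y := by
  have hne : (Submodule.Quotient.mk ⟨x, hx⟩ : RelQuot P Q) ≠ 0 := fun h0 =>
    hxP ((Submodule.Quotient.mk_eq_zero (P.submoduleOf Q)).1 h0)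
  obtain ⟨c, hc⟩ := exists_smul_eq_of_finrank_eq_one h.2 hne (Submodule.Quotient.mk ⟨y, hy⟩)
  rw [← Submodule.Quotient.mk_smul, eq_comm, Submodule.Quotient.eq] at hc
  exact ⟨y - c • x, hc, c, by abel⟩

theorem leOfCodimOne_of_exists {P Q : Submodule k V} (hPQ : P ≤ Q) {x : V} (hx : x ∈ Q)
    (hxP : x ∉ P) (h : ∀ y ∈ Q, ∃ c : k, y - c • x ∈ P) : LeOfCodimOne P Q := by
  refine ⟨hPQ, finrank_eq_one (Submodule.Quotient.mk ⟨x, hx⟩ : RelQuot P Q) ?_ ?_⟩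
  · exact fun h0 => hxP ((Submodule.Quotient.mk_eq_zero (P.submoduleOf Q)).1 h0)
  · intro y
    obtain ⟨⟨y, hy⟩, rfl⟩ := Submodule.mkQ_surjective _ y
    obtain ⟨c, hc⟩ := h y hy
    refine ⟨c, ?_⟩
    rw [← Submodule.Quotient.mk_smul, eq_comm]
    exact (Submodule.Quotient.eq _).2 hc

end Relative

/-! ### Rational points and their complements -/

namespace GrassData

variable {k V : Type*} [Field k] [AddCommGroup V] [Module k V] (D : GrassData k V)

/-- Passing to a larger subspace can only increase `dim (L ∩ V⁺)` and decrease `dim V / (L + V⁺)`.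
Index `0` on both sides forces equality in both, and the modular law concludes. -/
theorem Gr_eq_of_le {L L' : D.Gr} (h : (L : Submodule k V) ≤ L') : L = L' := by
  obtain ⟨L, ⟨h1, h2⟩, hi⟩ := L
  obtain ⟨L', ⟨h1', h2'⟩, hi'⟩ := L'
  replace h : L ≤ L' := h
  have hle : L ⊓ D.plus ≤ L' ⊓ D.plus := inf_le_inf_right _ h
  have hle' : L ⊔ D.plus ≤ L' ⊔ D.plus := sup_le_sup_right h _
  have hf := Submodule.finrank_mono hle
  have hs : Function.Surjective (Submodule.factor hle') := Submodule.factor_surjective hle'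
  have hf' := LinearMap.finrank_le_finrank_of_surjective hs
  simp only [index] at hi hi'
  have e1 : L ⊓ D.plus = L' ⊓ D.plus := Submodule.eq_of_le_of_finrank_eq hle (by omega)
  have hinj : Function.Injective (Submodule.factor hle') :=
    (LinearMap.injective_iff_surjective_of_finrank_eq_finrank (by omega)).2 hs
  have e2 : L' ⊔ D.plus ≤ L ⊔ D.plus := by
    intro x hx
    rw [← Submodule.Quotient.mk_eq_zero]
    apply hinj
    rw [map_zero]
    exact (Submodule.Quotient.mk_eq_zero _).2 hx
  exact Subtype.ext (eq_of_le_of_inf_le_of_sup_le h e1.ge e2)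

theorem exists_mem_notMem {L L' : D.Gr} (h : L ≠ L') :
    ∃ x ∈ (L : Submodule k V), x ∉ (L' : Submodule k V) := by
  by_contra! h'
  exact h (D.Gr_eq_of_le h')

/-- A finite-dimensional subspace that meets a rational point `L` only in `0` is contained in a
complement of `L` in `𝓑₀`. -/
theorem exists_compl_ge (L : D.Gr) (E : Submodule k V) [FiniteDimensional k E]
    (hE : Disjoint (L : Submodule k V) E) :
    ∃ A ∈ D.nhdZero, IsCompl (L : Submodule k V) A ∧ E ≤ A := by
  obtain ⟨L, hL⟩ := L
  replace hE : Disjoint L E := hE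
  have hL1 := hL.1.1
  have hL2 := hL.1.2
  -- The image modulo `L` lies in that of `E`, and the part inside `L` lies in `L ∩ V⁺`; both are
  -- finite-dimensional.
  have hfin : FiniteDimensional k ↥((L ⊔ E) ⊓ D.plus) := by
    rw [← Submodule.fg_iff_finiteDimensional]
    refine Submodule.fg_of_fg_map_of_fg_inf_ker L.mkQ ?_ ?_
    · have hle : ((L ⊔ E) ⊓ D.plus).map L.mkQ ≤ E.map L.mkQ := by
        refine (Submodule.map_mono inf_le_left).trans ?_
        rw [Submodule.map_sup]
        simp
      exact (Submodule.fg_iff_finiteDimensional _).2 (Submodule.finiteDimensional_of_le hle)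
    · rw [Submodule.ker_mkQ]
      have hle : (L ⊔ E) ⊓ D.plus ⊓ L ≤ L ⊓ D.plus := le_inf inf_le_right
        (inf_le_left.trans inf_le_right)
      exact (Submodule.fg_iff_finiteDimensional _).2 (Submodule.finiteDimensional_of_le hle)
  obtain ⟨B₀, hB₀, hdis⟩ := D.exists_disjoint ((L ⊔ E) ⊓ D.plus)
  set B := D.plus ⊓ B₀ with hBdef
  have hB : B ∈ D.nhd := D.inf_mem _ D.plus_mem _ hB₀
  have hLB : Disjoint (L ⊔ E) B := by
    rw [disjoint_iff, hBdef, ← inf_assoc, hdis]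
  have hBsat : B ∈ D.nhdSat := ⟨B, hB, le_rfl, (finite_relQuot_iff _ _).2
    ⟨⊥, inferInstance, le_sup_left⟩⟩
  obtain ⟨F, hF, hPF⟩ := (D.nhdSat_le hBsat).2
  obtain ⟨G, hG⟩ := Submodule.exists_isCompl (L ⊔ D.plus)
  have hGf : FiniteDimensional k G :=
    LinearEquiv.finiteDimensional (Submodule.quotientEquivOfIsCompl _ _ hG)
  obtain ⟨C, hC⟩ := Submodule.exists_isCompl (L ⊔ (E ⊔ B))
  -- `F` recovers `V⁺` from `B`, and `G` completes `L + V⁺` to `V`; hence the complement `C` is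
  -- finite-dimensional and `E + B + C` is still a neighbourhood.
  have htop : (⊤ : Submodule k V) ≤ (L ⊔ (E ⊔ B)) ⊔ (F ⊔ G) := by
    rw [← hG.sup_eq_top]
    refine sup_le (sup_le (le_sup_left.trans le_sup_left) (hPF.trans ?_))
      (le_sup_right.trans le_sup_right)
    exact sup_le_sup (le_sup_right.trans le_sup_right) le_sup_left
  have hCf : FiniteDimensional k C := by
    have hq : FiniteDimensional k (V ⧸ (L ⊔ (E ⊔ B))) := by
      have hs : (F ⊔ G).map (L ⊔ (E ⊔ B)).mkQ = ⊤ := by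
        rw [eq_top_iff, ← Submodule.range_mkQ (L ⊔ (E ⊔ B)), LinearMap.range_eq_map]
        refine (Submodule.map_mono htop).trans ?_
        rw [Submodule.map_sup, Submodule.mkQ_map_self, bot_sup_eq]
      exact Module.finite_def.2 (hs ▸ (Submodule.fg_iff_finiteDimensional _).2 inferInstance)
    exact LinearEquiv.finiteDimensional (Submodule.quotientEquivOfIsCompl _ _ hC)
  have hcompl : IsCompl L (E ⊔ B ⊔ C) := by
    refine ⟨Disjoint.disjoint_sup_right_of_disjoint_sup_left
      (hE.disjoint_sup_right_of_disjoint_sup_left hLB) hC.disjoint, ?_⟩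
    rw [codisjoint_iff, ← sup_assoc, hC.sup_eq_top]
  have hsat : E ⊔ B ⊔ C ∈ D.nhdSat :=
    ⟨B, hB, le_sup_right.trans le_sup_left, (finite_relQuot_iff _ _).2 ⟨E ⊔ C, inferInstance,
      sup_le (sup_le (le_sup_left.trans le_sup_right) le_sup_left)
        (le_sup_right.trans le_sup_right)⟩⟩
  exact ⟨_, D.mem_nhdZero_of_isCompl hL hsat hcompl, hcompl, le_sup_left.trans le_sup_left⟩

/-! ### Linear forms on `Ω` attached to frames -/

variable {D}

/-- The section of `Ω` attached to a relative frame. -/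
noncomputable def omegaSection {A : Submodule k V} (hA : A ∈ D.nhdZero) (θ : D.RelFrame A) :
    D.Omega :=
  ⟨D.sectionAt θ, Submodule.subset_span ⟨A, hA, θ, rfl⟩⟩

/-- The linear form on `Ω` given by the value at a frame `w` of `L`. -/
noncomputable def evalFrame {L : D.Gr} (w : D.Frame (L : Submodule k V)) : Module.Dual k D.Omega :=
  (LinearMap.proj w ∘ₗ (D.detDual (L : Submodule k V)).subtype) ∘ₗ D.evalAt L

theorem evalFrame_omegaSection {L : D.Gr} (w : D.Frame (L : Submodule k V)) {A : Submodule k V}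
    (hA : A ∈ D.nhdZero) (θ : D.RelFrame A) :
    evalFrame w (omegaSection hA θ) = fdet (sectionMap θ w) := rfl

theorem dual_Omega_ext {f g : Module.Dual k D.Omega}
    (h : ∀ (A : Submodule k V) (hA : A ∈ D.nhdZero) (θ : D.RelFrame A),
      f (omegaSection hA θ) = g (omegaSection hA θ)) : f = g := by
  apply LinearMap.ext
  rintro ⟨s, hs⟩
  induction hs using Submodule.span_induction with
  | mem s hs =>
    obtain ⟨A, hA, θ, rfl⟩ := hs
    exact h A hA θ
  | zero => exact (map_zero f).trans (map_zero g).symm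
  | add s t hs ht ihs iht =>
    have := congrArg₂ (· + ·) ihs iht
    simp only [← map_add] at this
    exact this
  | smul c s hs ih =>
    have := congrArg (c • ·) ih
    simp only [← map_smul] at this
    exact this

/-- A common vector of `L` and `A` dies in `V / A`, so its preimage under the frame is in the kernel
of `sectionMap θ w`. -/
theorem evalFrame_omegaSection_eq_zero {L : D.Gr} (w : D.Frame (L : Submodule k V))
    {A : Submodule k V} (hA : A ∈ D.nhdZero) (θ : D.RelFrame A) {x : V} (hx : x ≠ 0)
    (hxL : x ∈ (L : Submodule k V)) (hxA : x ∈ A) : evalFrame w (omegaSection hA θ) = 0 := by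
  rw [evalFrame_omegaSection]
  have := D.finite_range_sectionMap θ w
  refine fdet_eq_zero_of_apply_eq_zero _ (x := w.1.symm ⟨x, hxL⟩) ?_ ?_
  · rw [Ne, LinearEquiv.map_eq_zero_iff]
    exact fun h => hx (congrArg Subtype.val h)
  · simp [sectionMap, proj, hxA]

/-- Some section does not vanish at `L`, but vanishes at all points that meet a given
finite-dimensional subspace disjoint from `L`. -/
theorem exists_evalFrame_eq_one {L : D.Gr} (w : D.Frame (L : Submodule k V))
    (E : Submodule k V) [FiniteDimensional k E] (hE : Disjoint (L : Submodule k V) E) :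
    ∃ s : D.Omega, evalFrame w s = 1 ∧ ∀ (L' : D.Gr) (w' : D.Frame (L' : Submodule k V)),
      ∀ x ∈ E, x ≠ 0 → x ∈ (L' : Submodule k V) → evalFrame w' s = 0 := by
  obtain ⟨A, hA, hLA, hEA⟩ := D.exists_compl_ge L E hE
  obtain ⟨θ, hθ⟩ := D.exists_relFrame hA hLA w
  refine ⟨omegaSection hA θ, ?_, fun L' w' x hx hx0 hxL' =>
    evalFrame_omegaSection_eq_zero w' hA θ hx0 hxL' (hEA hx)⟩
  rw [evalFrame_omegaSection, hθ, fdet_one]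

theorem evalFrame_ne_zero {L : D.Gr} (w : D.Frame (L : Submodule k V)) : evalFrame w ≠ 0 := by
  obtain ⟨s, hs, -⟩ := exists_evalFrame_eq_one w ⊥ disjoint_bot_right
  intro h
  rw [h] at hs
  exact zero_ne_one hs

/-- Evaluation at `w` is a linear form on `D_L`, so its pullback `evalFrame w` lies in the Plücker
line; being nonzero, it spans that line. -/
theorem plucker_submodule {L : D.Gr} (w : D.Frame (L : Submodule k V)) :
    (D.plucker L).submodule = Submodule.span k {evalFrame w} := by
  rw [plucker, Projectivization.submodule_mk'']
  have h1 := D.finrank_range_dualMap L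
  have : FiniteDimensional k (LinearMap.range (D.evalAt L).dualMap) :=
    FiniteDimensional.of_finrank_pos (by omega)
  refine (Submodule.eq_of_le_of_finrank_eq ?_ ?_).symm
  · rw [Submodule.span_singleton_le_iff_mem]
    exact ⟨LinearMap.proj w ∘ₗ (D.detDual (L : Submodule k V)).subtype, rfl⟩
  · rw [h1, finrank_span_singleton (evalFrame_ne_zero w)]

/-- The Plücker images of distinct points are distinct. -/
theorem linearIndependent_evalFrame {L L' : D.Gr} (h : L ≠ L')
    (w : D.Frame (L : Submodule k V)) (w' : D.Frame (L' : Submodule k V)) :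
    LinearIndependent k ![evalFrame w, evalFrame w'] := by
  rw [LinearIndependent.pair_iff' (evalFrame_ne_zero w)]
  intro c hc
  obtain ⟨x, hx, hx'⟩ := D.exists_mem_notMem h
  have hx0 : x ≠ 0 := fun h0 => hx' (h0 ▸ zero_mem _)
  obtain ⟨s, hs, hs'⟩ := exists_evalFrame_eq_one w' (Submodule.span k {x})
    ((Submodule.disjoint_span_singleton' hx0).2 hx')
  have := hs' L w x (Submodule.mem_span_singleton_self x) hx0 hx
  rw [← hc, LinearMap.smul_apply, this, smul_zero] at hs
  exact zero_ne_one hs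

/-- The first two forms are independent, so their span is the only plane that can contain all three
points. -/
theorem lieInALine_iff {L₁ L₂ L₃ : D.Gr} (h : L₁ ≠ L₂) (w₁ : D.Frame (L₁ : Submodule k V))
    (w₂ : D.Frame (L₂ : Submodule k V)) (w₃ : D.Frame (L₃ : Submodule k V)) :
    LieInALine (D.plucker L₁) (D.plucker L₂) (D.plucker L₃) ↔
      evalFrame w₃ ∈ Submodule.span k {evalFrame w₁, evalFrame w₂} := by
  have hli := linearIndependent_evalFrame h w₁ w₂
  have hfr := finrank_span_eq_card hli
  have hr : Set.range ![evalFrame w₁, evalFrame w₂] = {evalFrame w₁, evalFrame w₂} := by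
    simp [Matrix.range_cons, Set.pair_comm]
  rw [hr, Fintype.card_fin] at hfr
  simp only [LieInALine, plucker_submodule w₁, plucker_submodule w₂, plucker_submodule w₃,
    Submodule.span_singleton_le_iff_mem]
  constructor
  · rintro ⟨W, hW, h1, h2, h3⟩
    -- `finrank` is `0` in infinite dimension, so the value `2` forces finiteness.
    have : FiniteDimensional k W := FiniteDimensional.of_finrank_pos (by omega)
    have hle : Submodule.span k {evalFrame w₁, evalFrame w₂} ≤ W :=
      Submodule.span_le.2 (Set.pair_subset h1 h2)
    rwa [Submodule.eq_of_le_of_finrank_eq hle (hfr.trans hW.symm)]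
  · intro h3
    exact ⟨_, hfr, Submodule.subset_span (by simp), Submodule.subset_span (by simp), h3⟩

/-! ### Consequences of collinearity -/

/-- Vectors of `L₁` and of `L₂` outside `L₃` are proportional modulo `L₃` if the three points are
collinear. -/
theorem exists_smul_sub_mem {L₁ L₂ L₃ : D.Gr} (h : L₁ ≠ L₂)
    (hl : LieInALine (D.plucker L₁) (D.plucker L₂) (D.plucker L₃)) {x y : V}
    (hx : x ∈ (L₁ : Submodule k V)) (hx3 : x ∉ (L₃ : Submodule k V))
    (hy : y ∈ (L₂ : Submodule k V)) :
    ∃ c : k, y - c • x ∈ (L₃ : Submodule k V) := by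
  by_contra! hc
  obtain ⟨w₁⟩ := D.exists_frame L₁
  obtain ⟨w₂⟩ := D.exists_frame L₂
  obtain ⟨w₃⟩ := D.exists_frame L₃
  obtain ⟨a, b, hab⟩ := Submodule.mem_span_pair.1 ((lieInALine_iff h w₁ w₂ w₃).1 hl)
  have hx0 : x ≠ 0 := fun h0 => hx3 (h0 ▸ zero_mem _)
  have hy0 : y ≠ 0 := fun h0 => hc 0 (by simp [h0])
  -- Otherwise some nonzero `α x + β y` lies in `L₃`: for `β ≠ 0`, dividing by `β` makes `y` a
  -- multiple of `x` modulo `L₃`; for `β = 0`, `x` itself lies in `L₃`.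
  have hdis : Disjoint (L₃ : Submodule k V) (Submodule.span k {x, y}) := by
    rw [Submodule.disjoint_def]
    intro z hz hz'
    obtain ⟨α, β, rfl⟩ := Submodule.mem_span_pair.1 hz'
    have hβ : β = 0 := by
      by_contra hβ
      refine hc (-(β⁻¹ * α)) ?_
      have := (L₃ : Submodule k V).smul_mem β⁻¹ hz
      rw [smul_add, smul_smul, smul_smul, inv_mul_cancel₀ hβ, one_smul] at this
      rwa [neg_smul, sub_neg_eq_add, add_comm]
    subst hβ
    rw [zero_smul, add_zero] at hz ⊢
    by_contra hne
    have hα : α ≠ 0 := fun h0 => hne (by simp [h0])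
    exact hx3 (((L₃ : Submodule k V).smul_mem_iff hα).1 hz)
  have : FiniteDimensional k (Submodule.span k {x, y}) :=
    FiniteDimensional.span_of_finite k (Set.toFinite _)
  obtain ⟨s, hs, hs'⟩ := exists_evalFrame_eq_one w₃ _ hdis
  have h1 := hs' L₁ w₁ x (Submodule.subset_span (by simp)) hx0 hx
  have h2 := hs' L₂ w₂ y (Submodule.subset_span (by simp)) hy0 hy
  rw [← hab, LinearMap.add_apply, LinearMap.smul_apply, LinearMap.smul_apply, h1, h2] at hs
  simp at hs

/-- The intersection of two of three collinear points is contained in the third. -/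
theorem inf_le_of_lieInALine {L₁ L₂ L₃ : D.Gr} (h : L₁ ≠ L₂)
    (hl : LieInALine (D.plucker L₁) (D.plucker L₂) (D.plucker L₃)) :
    (L₁ : Submodule k V) ⊓ L₂ ≤ L₃ := by
  rintro x ⟨hx1, hx2⟩
  by_contra hx3
  obtain ⟨w₁⟩ := D.exists_frame L₁
  obtain ⟨w₂⟩ := D.exists_frame L₂
  obtain ⟨w₃⟩ := D.exists_frame L₃
  obtain ⟨a, b, hab⟩ := Submodule.mem_span_pair.1 ((lieInALine_iff h w₁ w₂ w₃).1 hl)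
  have hx0 : x ≠ 0 := fun h0 => hx3 (h0 ▸ zero_mem _)
  obtain ⟨s, hs, hs'⟩ := exists_evalFrame_eq_one w₃ (Submodule.span k {x})
    ((Submodule.disjoint_span_singleton' hx0).2 hx3)
  have hxs := Submodule.mem_span_singleton_self (R := k) x
  rw [← hab, LinearMap.add_apply, LinearMap.smul_apply, LinearMap.smul_apply,
    hs' L₁ w₁ x hxs hx0 hx1, hs' L₂ w₂ x hxs hx0 hx2] at hs
  simp at hs

/-- `exists_smul_sub_mem` only compares vectors of different points. Two vectors of `L₁` are
therefore compared through some `y ∈ L₂` outside `L₃`. -/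
theorem exists_forall_sub_smul_mem {L₁ L₂ L₃ : D.Gr} (h₁₂ : L₁ ≠ L₂) (h₁₃ : L₁ ≠ L₃)
    (h₂₃ : L₂ ≠ L₃) (hl : LieInALine (D.plucker L₁) (D.plucker L₂) (D.plucker L₃)) :
    ∃ x ∈ (L₁ : Submodule k V), x ∉ (L₃ : Submodule k V) ∧
      ∀ l ∈ (L₁ : Submodule k V) ⊔ L₂, ∃ c : k, l - c • x ∈ (L₃ : Submodule k V) := by
  obtain ⟨x, hx, hx3⟩ := D.exists_mem_notMem h₁₃
  obtain ⟨y, hy, hy3⟩ := D.exists_mem_notMem h₂₃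
  refine ⟨x, hx, hx3, fun l hl' => ?_⟩
  obtain ⟨l₁, hl₁, l₂, hl₂, rfl⟩ := Submodule.mem_sup.1 hl'
  have hlswap : LieInALine (D.plucker L₂) (D.plucker L₁) (D.plucker L₃) := by
    obtain ⟨W, hW, h1, h2, h3⟩ := hl
    exact ⟨W, hW, h2, h1, h3⟩
  obtain ⟨a, ha⟩ := exists_smul_sub_mem h₁₂ hl hx hx3 hl₂
  obtain ⟨b, hb⟩ := exists_smul_sub_mem h₁₂ hl hx hx3 hy
  obtain ⟨c, hc⟩ := exists_smul_sub_mem h₁₂.symm hlswap hy hy3 hl₁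
  refine ⟨a + c * b, ?_⟩
  have : l₁ + l₂ - (a + c * b) • x = (l₁ - c • y) + c • (y - b • x) + (l₂ - a • x) := by
    module
  rw [this]
  exact add_mem (add_mem hc (Submodule.smul_mem _ c hb)) ha

/-! ### Pencils -/

/-- If `L'` differs from `L` in one direction only, a frame of `L` can be changed into a frame of
`L'` in that direction only. -/
theorem Frame.exists_change {L L' I : Submodule k V} (w : D.Frame L) {x y : V} (hx : x ∈ L)
    (hIL : I ≤ L) (hL : ∀ l ∈ L, ∃ i ∈ I, ∃ c : k, i + c • x = l) (hIL' : I ≤ L') (hy : y ∈ L')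
    (hyI : y ∉ I) (hL' : ∀ l ∈ L', ∃ i ∈ I, ∃ c : k, i + c • y = l) {f : V →ₗ[k] k}
    (hfI : ∀ i ∈ I, f i = 0) (hfx : f x = 1) :
    ∃ w' : D.Frame L', ∀ v, (w'.1 v : V) = w.1 v + f (w.1 v) • (y - x) := by
  -- The map `l ↦ l + f(l)(y - x)` fixes `I` and sends `x` to `y`, hence carries `L = I + kx` onto
  -- `L' = I + ky`.
  let g : (V ⧸ D.plus) →ₗ[k] V := L.subtype ∘ₗ w.1.toLinearMap +
    (f ∘ₗ L.subtype ∘ₗ w.1.toLinearMap).smulRight (y - x)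
  have hg : ∀ v, g v = w.1 v + f (w.1 v) • (y - x) := fun v => rfl
  have hgi : ∀ v, ∀ i ∈ I, ∀ c : k, i + c • x = w.1 v → g v = i + c • y := by
    intro v i hi c hv
    rw [hg, ← hv, map_add, hfI i hi, map_smul, hfx, zero_add, smul_eq_mul, mul_one, smul_sub]
    abel
  have hinj : Function.Injective g := by
    rw [injective_iff_map_eq_zero]
    intro v hv
    obtain ⟨i, hi, c, hic⟩ := hL _ (w.1 v).2
    rw [hgi v i hi c hic] at hv
    have hc : c = 0 := by
      by_contra hc
      refine hyI ((I.smul_mem_iff hc).1 ?_)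
      rw [eq_neg_of_add_eq_zero_right hv]
      exact I.neg_mem hi
    subst hc
    rw [zero_smul, add_zero] at hv hic
    rw [← w.1.map_eq_zero_iff]
    exact Subtype.ext (hic.symm.trans hv)
  have hrange : LinearMap.range g = L' := by
    apply le_antisymm
    · rintro _ ⟨v, rfl⟩
      obtain ⟨i, hi, c, hic⟩ := hL _ (w.1 v).2
      rw [hgi v i hi c hic]
      exact L'.add_mem (hIL' hi) (L'.smul_mem c hy)
    · intro l hl
      obtain ⟨i, hi, c, rfl⟩ := hL' l hl
      refine ⟨w.1.symm ⟨i + c • x, L.add_mem (hIL hi) (L.smul_mem c hx)⟩, ?_⟩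
      exact hgi _ i hi c (by simp)
  let e : (V ⧸ D.plus) ≃ₗ[k] L' :=
    LinearEquiv.ofInjective g hinj ≪≫ₗ LinearEquiv.ofEq _ _ hrange
  have he : ∀ v, (e v : V) = g v := fun v => rfl
  refine ⟨⟨e, ?_⟩, fun v => (he v).trans (hg v)⟩
  -- The deviation from the identity changes by an operator factoring through `k`, so it stays of
  -- finite rank.
  have hsum : proj D.plus L' ∘ₗ e.toLinearMap - 1 = (proj D.plus L ∘ₗ w.1.toLinearMap - 1) +
      (LinearMap.toSpanSingleton k _ (D.plus.mkQ (y - x))) ∘ₗ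
        (f ∘ₗ L.subtype ∘ₗ w.1.toLinearMap) := by
    apply LinearMap.ext
    intro v
    simp only [proj, LinearMap.sub_apply, LinearMap.comp_apply, LinearMap.add_apply,
      LinearEquiv.coe_coe, Submodule.subtype_apply, he, hg, map_add, map_smul,
      LinearMap.toSpanSingleton_apply]
    abel
  rw [hsum]
  exact finite_range_add _ _ w.2 (finite_range_comp_right _ _ inferInstance)

/-- The Plücker images of the members of a pencil are collinear. -/
theorem lieInALine_of_pencil {L₁ L₂ L₃ : D.Gr} (h : L₁ ≠ L₂) {I : Submodule k V} {x y : V}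
    (hxI : x ∉ I) (hyI : y ∉ I) (hzI : x + y ∉ I)
    (hx : x ∈ (L₁ : Submodule k V)) (hy : y ∈ (L₂ : Submodule k V))
    (hz : x + y ∈ (L₃ : Submodule k V)) (hI₁ : I ≤ (L₁ : Submodule k V))
    (hI₂ : I ≤ (L₂ : Submodule k V)) (hI₃ : I ≤ (L₃ : Submodule k V))
    (hL₁ : ∀ l ∈ (L₁ : Submodule k V), ∃ i ∈ I, ∃ c : k, i + c • x = l)
    (hL₂ : ∀ l ∈ (L₂ : Submodule k V), ∃ i ∈ I, ∃ c : k, i + c • y = l)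
    (hL₃ : ∀ l ∈ (L₃ : Submodule k V), ∃ i ∈ I, ∃ c : k, i + c • (x + y) = l) :
    LieInALine (D.plucker L₁) (D.plucker L₂) (D.plucker L₃) := by
  obtain ⟨f₀, hf₀x, hf₀⟩ := Submodule.exists_le_ker_of_notMem hxI
  let f : V →ₗ[k] k := (f₀ x)⁻¹ • f₀
  have hfx : f x = 1 := inv_mul_cancel₀ hf₀x
  have hfI : ∀ i ∈ I, f i = 0 := by
    intro i hi
    have : f₀ i = 0 := hf₀ hi
    simp [f, this]
  obtain ⟨w₁⟩ := D.exists_frame L₁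
  obtain ⟨w₂, hw₂⟩ := w₁.exists_change hx hI₁ hL₁ hI₂ hy hyI hL₂ hfI hfx
  obtain ⟨w₃, hw₃⟩ := w₁.exists_change hx hI₁ hL₁ hI₃ hz hzI hL₃ hfI hfx
  -- Both coefficients are `1` because the direction of `L₃` is exactly `x + y` and all three frames
  -- come from `w₁`.
  refine (lieInALine_iff h w₁ w₂ w₃).2 (Submodule.mem_span_pair.2 ⟨1, 1, ?_⟩)
  rw [one_smul, one_smul]
  refine dual_Omega_ext fun A hA θ => ?_
  rw [LinearMap.add_apply]
  simp only [evalFrame_omegaSection]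
  have h1 := D.finite_range_sectionMap θ w₁
  have h2 := D.finite_range_sectionMap θ w₂
  have h3 := D.finite_range_sectionMap θ w₃
  have hmap : ∀ (L : D.Gr) (w : D.Frame (L : Submodule k V)) (v : V ⧸ D.plus),
      sectionMap θ w v = θ.1 (A.mkQ (w.1 v)) := fun _ _ _ => rfl
  -- The three frames agree where `f ∘ w₁` vanishes; at `w₁⁻¹ x` they take the values `x`, `y`, `x +
  -- y`.
  refine (fdet_add_of_eqOn_ker (f ∘ₗ (L₁ : Submodule k V).subtype ∘ₗ w₁.1.toLinearMap)
    (p := w₁.1.symm ⟨x, hx⟩) (by simp [hfx]) ?_ ?_ ?_).symm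
  · intro v hv
    replace hv : f (w₁.1 v) = 0 := hv
    rw [hmap, hmap, hw₃, hv, zero_smul, add_zero]
  · intro v hv
    replace hv : f (w₁.1 v) = 0 := hv
    rw [hmap, hmap, hw₂, hw₃, hv, zero_smul, zero_smul]
  · rw [hmap, hmap, hmap, hw₂, hw₃, LinearEquiv.apply_symm_apply, ← map_add, ← map_add]
    simp only [hfx, one_smul]
    congr 2
    abel

end GrassData

end InfGrass

/-! ### The criterion for collinearity -/

open InfGrass InfGrass.GrassData in
theorem mainTheorem6 {k V : Type*} [Field k] [AddCommGroup V] [Module k V]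
    (D : InfGrass.GrassData k V) (L₁ L₂ L₃ : D.Gr)
    (h₁₂ : L₁ ≠ L₂) (h₁₃ : L₁ ≠ L₃) (h₂₃ : L₂ ≠ L₃) :
    InfGrass.LieInALine (D.plucker L₁) (D.plucker L₂) (D.plucker L₃) ↔
      InfGrass.LeOfCodimOne ((L₁ : Submodule k V) ⊓ L₂) (L₃ : Submodule k V) ∧
        InfGrass.LeOfCodimOne (L₃ : Submodule k V) ((L₁ : Submodule k V) ⊔ L₂) := by
  constructor
  · intro hl
    have hl' : InfGrass.LieInALine (D.plucker L₃) (D.plucker L₁) (D.plucker L₂) := by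
      obtain ⟨W, hW, h1, h2, h3⟩ := hl
      exact ⟨W, hW, h3, h1, h2⟩
    have hl'' : InfGrass.LieInALine (D.plucker L₂) (D.plucker L₃) (D.plucker L₁) := by
      obtain ⟨W, hW, h1, h2, h3⟩ := hl
      exact ⟨W, hW, h2, h3, h1⟩
    obtain ⟨x, hx1, hx3, hx⟩ := exists_forall_sub_smul_mem h₁₂ h₁₃ h₂₃ hl
    obtain ⟨u, hu3, hu2, hu⟩ := exists_forall_sub_smul_mem h₁₃.symm h₂₃.symm h₁₂ hl'
    obtain ⟨y, hy2, hy1, hy⟩ := exists_forall_sub_smul_mem h₂₃ h₁₂.symm h₁₃.symm hl''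
    have h23 : (L₂ : Submodule k V) ⊓ L₃ ≤ L₁ := inf_le_of_lieInALine h₂₃ hl''
    refine ⟨leOfCodimOne_of_exists (inf_le_of_lieInALine h₁₂ hl) hu3 (fun h => hu2 h.2) ?_,
      leOfCodimOne_of_exists ?_ (Submodule.mem_sup_left hx1) hx3 hx⟩
    -- Modulo `L₂`, a vector of `L₃` is a multiple of `u ∈ L₃`; the difference lies in `L₂ ∩ L₃ ⊆
    -- L₁`.
    · intro l hl
      obtain ⟨c, hc⟩ := hu l (Submodule.mem_sup_left hl)
      exact ⟨c, h23 ⟨hc, sub_mem hl (Submodule.smul_mem _ c hu3)⟩, hc⟩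
    -- Modulo `L₁`, a vector of `L₃` is a multiple of `y ∈ L₂`, whence `L₃ ⊆ L₁ + L₂`.
    · intro l hl
      obtain ⟨c, hc⟩ := hy l (Submodule.mem_sup_right hl)
      have := add_mem (Submodule.mem_sup_left (T := (L₂ : Submodule k V)) hc)
        (Submodule.mem_sup_right (S := (L₁ : Submodule k V)) (Submodule.smul_mem _ c hy2))
      rwa [sub_add_cancel] at this
  · rintro ⟨hI, hJ⟩
    obtain ⟨z, hz3, hzI⟩ := hI.exists_notMem
    -- Splitting a generator of `L₃` modulo `L₁ ∩ L₂` supplies the directions of `L₁` and `L₂`.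
    obtain ⟨x, hx, y, hy, rfl⟩ := Submodule.mem_sup.1 (hJ.1 hz3)
    have hL₃ := fun l hl => hI.exists_add_smul hz3 hzI (y := l) hl
    -- If `x ∈ L₂`, then `x + y ∈ L₂`, so `L₃ ⊆ L₂`, which index `0` turns into equality.
    have hx2 : x ∉ (L₂ : Submodule k V) := by
      intro hx2
      refine h₂₃ (D.Gr_eq_of_le fun l hl => ?_).symm
      obtain ⟨i, hi, c, rfl⟩ := hL₃ l hl
      exact add_mem hi.2 (Submodule.smul_mem _ c (add_mem hx2 hy))
    have hy1 : y ∉ (L₁ : Submodule k V) := by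
      intro hy1
      refine h₁₃ (D.Gr_eq_of_le fun l hl => ?_).symm
      obtain ⟨i, hi, c, rfl⟩ := hL₃ l hl
      exact add_mem hi.1 (Submodule.smul_mem _ c (add_mem hx hy1))
    have hx3 : x ∉ (L₃ : Submodule k V) := by
      intro hx3
      obtain ⟨i, hi, c, hic⟩ := hL₃ x hx3
      have hc : c = 0 := by
        by_contra hc
        refine hy1 (((L₁ : Submodule k V).smul_mem_iff hc).1 ?_)
        have : c • y = x - i - c • x := by
          nth_rewrite 1 [← hic]
          module
        rw [this]
        exact sub_mem (sub_mem hx hi.1) (Submodule.smul_mem _ c hx)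
      subst hc
      rw [zero_smul, add_zero] at hic
      exact hx2 (hic ▸ hi.2)
    -- Since `x ∉ L₃`, `L₁ + L₂ = L₃ + kx = I + k(x + y) + kx`. Below, `y ∉ L₁` and `x ∉ L₂` kill
    -- the unwanted coefficient.
    have hsup : ∀ l ∈ (L₁ : Submodule k V) ⊔ L₂,
        ∃ i ∈ (L₁ : Submodule k V) ⊓ L₂, ∃ a b : k, i + a • x + b • y = l := by
      intro l hl
      obtain ⟨m, hm, c, rfl⟩ := hJ.exists_add_smul (Submodule.mem_sup_left hx) hx3 hl
      obtain ⟨i, hi, d, rfl⟩ := hL₃ m hm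
      exact ⟨i, hi, d + c, d, by module⟩
    refine lieInALine_of_pencil (I := (L₁ : Submodule k V) ⊓ L₂) h₁₂ (fun h => hx2 h.2)
      (fun h => hy1 h.1) hzI hx hy hz3 inf_le_left inf_le_right hI.1 ?_ ?_ hL₃
    · intro l hl
      obtain ⟨i, hi, a, b, rfl⟩ := hsup l (Submodule.mem_sup_left hl)
      have hb : b = 0 := by
        by_contra hb
        refine hy1 (((L₁ : Submodule k V).smul_mem_iff hb).1 ?_)
        exact ((L₁ : Submodule k V).add_mem_iff_right
          (add_mem hi.1 (Submodule.smul_mem _ a hx))).1 hl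
      exact ⟨i, hi, a, by simp [hb]⟩
    · intro l hl
      obtain ⟨i, hi, a, b, rfl⟩ := hsup l (Submodule.mem_sup_right hl)
      have ha : a = 0 := by
        by_contra ha
        refine hx2 (((L₂ : Submodule k V).smul_mem_iff ha).1 ?_)
        exact ((L₂ : Submodule k V).add_mem_iff_right hi.2).1
          (((L₂ : Submodule k V).add_mem_iff_left (Submodule.smul_mem _ b hy)).1 hl)
      exact ⟨i, hi, b, by simp [ha]⟩
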